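/- **Notation.** Write $|x|$ for the length of a binary string $x$. A $(k_q,k_a,k_o)$-query tree is a finite rooted tree in which every inner node is labelled by a query in $\{0,1\}^{k_q}$ and has exactly one outgoing edge for each answer $w\in\{0,1\}^{k_a}$, and every leaf is labelled by an output in $\{0,1\}^{k_o}$. On an oracle $\mathcal O:\{0,1\}^{k_q}\to\{0,1\}^{k_a}$ it computes the label $T(\mathcal O)$ of the leaf reached from the root by following, from a node with label $q$, the edge $\mathcal O(q)$. Its depth is the length of a longest path starting at the root. **Problems.** A $\mathrm{TFNP}^{dt}$ problem $P$ consists of length functions $\ell_a,\ell_s:\mathbb N\to\mathbb N$ such that $1^k\mapsto 1^{\ell_a(k)}$ and $1^k\mapsto 1^{\ell_s(k)}$ are computable in polynomial time, and a relation $P(\mathcal O,x,y)$ between a size parameter $x\in\{0,1\}^*$, an oracle $\mathcal O:\{0,1\}^{|x|}\to\{0,1\}^{\ell_a(|x|)}$ and a solution $y\in\{0,1\}^{\ell_s(|x|)}$. For every $(\mathcal O,x)$ a solution must exist, and there must be a polynomial $p$ such that for all $x,y$ some $(|x|,\ell_a(|x|),1)$-query tree of depth at most $p(|x|)$ decides $P(\mathcal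 O,x,y)$ for every $\mathcal O$. * $\textsc{WeakPigeon}$: given $x$ and $\mathcal O:\{0,1\}^{|x|}\to\{0,1\}^{|x|-1}$, find distinct $x_1,x_2\in\{0,1\}^{|x|}$ with $\mathcal O(x_1)=\mathcal O(x_2)$. * $\textsc{RetractionWeakPigeon}$: given $x$, $f:\{0,1\}^{|x|}\to\{0,1\}^{|x|-1}$ and $g:\{0,1\}^{|x|-1}\to\{0,1\}^{|x|}$, find $x'\in\{0,1\}^{|x|}$ with $g(f(x'))\ne x'$. The pair $(f,g)$ is presented by a single oracle $\mathcal O:\{0,1\}^{|x|}\to\{0,1\}^{(|x|-1)+|x|}$ answering in parallel: $f(z)$ is the first part of $\mathcal O(z)$, and $g(z)$ is the second part of $\mathcal O(0z)$. In the degenerate case $|x|=0$ (where $|x|-1$ is read as $0$) every candidate counts as a solution of either problem. **Reductions.** Let $P,Q$ be $\mathrm{TFNP}^{dt}$ problems with length functions $\ell^P_a,\ell^P_s$ and $\ell^Q_a,\ell^Q_s$. $P$ is many-one reducible to $Q$ if there are a polynomial-time computable $r:\{0,1\}^*\to\{0,1\}^*$ and a polynomial $p$ such that for every $x\in\{0,1\}^*$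 there are $(|x|,\ell^P_a(|x|),\ell^Q_a(|r(x)|))$-query trees $T^I_{x'}$ for $x'\in\{0,1\}^{|r(x)|}$ and $(|x|,\ell^P_a(|x|),\ell^P_s(|x|))$-query trees $T^s_{y'}$ for $y'\in\{0,1\}^{\ell^Q_s(|r(x)|)}$, all of depth at most $p(|x|)$, with the following property: for every instance $(\mathcal O,x)$ of $P$, if $\mathcal O'$ denotes the oracle $x'\mapsto T^I_{x'}(\mathcal O)$ on $\{0,1\}^{|r(x)|}$, then $Q(\mathcal O',r(x),y')$ implies $P(\mathcal O,x,T^s_{y'}(\mathcal O))$ for every $y'\in\{0,1\}^{\ell^Q_s(|r(x)|)}$. **Theorem.** $\textsc{WeakPigeon}$ is not many-one reducible to $\textsc{RetractionWeakPigeon}$. -/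

import Mathlib

/-- Binary strings of length `n`. -/
abbrev Bits (n : ℕ) : Type := Fin n → Bool

/-- A `(kq, ka, ko)`-query tree: inner nodes are labelled by queries of length `kq` and have one
outgoing edge for every answer of length `ka`; leaves are labelled by outputs of length `ko`. -/
inductive QueryTree (kq ka ko : ℕ) : Type
  | leaf (out : Bits ko) : QueryTree kq ka ko
  | node (query : Bits kq) (child : Bits ka → QueryTree kq ka ko) : QueryTree kq ka ko

namespace QueryTree

/-- The number of edges on a longest path from the root to a leaf. -/
def depth {kq ka ko : ℕ} : QueryTree kq ka ko → ℕ
  | leaf _ => 0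
  | node _ child => (Finset.univ.sup fun w => (child w).depth) + 1

/-- The output of the computation of a query tree on an oracle. -/
def run {kq ka ko : ℕ} (O : Bits kq → Bits ka) : QueryTree kq ka ko → Bits ko
  | leaf out => out
  | node query child => (child (O query)).run O

end QueryTree

/-- A function on binary strings is computable by a Turing machine in polynomial time. -/
def PolyTimeFun (r : List Bool → List Bool) : Prop :=
  Nonempty (Turing.TM2ComputableInPolyTime (id : List Bool → List Bool)
    (id : List Bool → List Bool) r)

/-- A length function is polynomial time when numbers are given in unary, that is,
`1 ^ k ↦ 1 ^ (l k)` is computable by a Turing machine in polynomial time. -/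
def PolyTimeLength (l : ℕ → ℕ) : Prop :=
  Nonempty (Turing.TM2ComputableInPolyTime Computability.unaryEncodeNat
    Computability.unaryEncodeNat l)

/-- A total query NP search problem. For a size parameter `x` an instance is given by an oracle
`O` on the strings of length `|x|`, with answers of length `la |x|`, and the candidate solutions
are the strings of length `ls |x|`. -/
structure QueryTFNP where
  la : ℕ → ℕ
  ls : ℕ → ℕ
  la_polyTime : PolyTimeLength la
  ls_polyTime : PolyTimeLength ls
  /-- `Sol x O y`: the string `y` is a solution of the instance `(O, x)`. -/
  Sol : (x : List Bool) → (Bits x.length → Bits (la x.length)) → Bits (ls x.length) → Prop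
  /-- Solutions are verified by query trees of polynomial depth (with a one-bit output). -/
  verifiable : ∃ p : Polynomial ℕ, ∀ (x : List Bool) (y : Bits (ls x.length)),
    ∃ T : QueryTree x.length (la x.length) 1, T.depth ≤ p.eval x.length ∧
      ∀ O, T.run O = (fun _ => true) ↔ Sol x O y
  /-- Every instance has a solution. -/
  total : ∀ x O, ∃ y, Sol x O y

/-- Many-one reducibility of query search problems. The size parameter is translated by a
polynomial-time function `r`; the oracle of the new instance is computed by the trees `TI x'`, and
the trees `Ts y'` translate solutions back. All trees have depth polynomial in `|x|`. -/
def QueryTFNP.ManyOneReducible (P Q : QueryTFNP) : Prop :=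
  ∃ r : List Bool → List Bool, PolyTimeFun r ∧ ∃ p : Polynomial ℕ, ∀ x : List Bool,
    ∃ (TI : Bits (r x).length →
          QueryTree x.length (P.la x.length) (Q.la (r x).length))
      (Ts : Bits (Q.ls (r x).length) →
          QueryTree x.length (P.la x.length) (P.ls x.length)),
      (∀ x', (TI x').depth ≤ p.eval x.length) ∧
      (∀ y', (Ts y').depth ≤ p.eval x.length) ∧
      ∀ (O : Bits x.length → Bits (P.la x.length)) (y' : Bits (Q.ls (r x).length)),
        Q.Sol (r x) (fun x' => (TI x').run O) y' → P.Sol x O ((Ts y').run O)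

/-- The first `a` bits of a string of length `a + b`. -/
def Bits.fst {a b : ℕ} (y : Bits (a + b)) : Bits a := fun i => y (Fin.castAdd b i)

/-- The last `b` bits of a string of length `a + b`. -/
def Bits.snd {a b : ℕ} (y : Bits (a + b)) : Bits b := fun i => y (Fin.natAdd a i)

/-- Prepend a leading zero to a string of length `k - 1` (for `k > 0`). -/
def Bits.pad {k : ℕ} (z : Bits (k - 1)) : Bits k := fun i =>
  if h : i.val = 0 then false else z ⟨i.val - 1, by have := i.isLt; omega⟩

/-! ### The length functions of the two problems are polynomial time -/

/-- The machine that removes one symbol from its only stack. -/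
def predMachine : Turing.FinTM2 where
  K := Unit
  k₀ := ()
  k₁ := ()
  Γ _ := Bool
  Λ := Unit
  main := ()
  σ := Unit
  initialState := ()
  m _ := .pop () (fun s _ => s) .halt

theorem polyTimeLength_id : PolyTimeLength fun k => k :=
  ⟨Turing.idComputableInPolyTime Computability.unaryEncodeNat⟩

theorem polyTimeLength_pred : PolyTimeLength fun k => k - 1 :=
  ⟨{ tm := predMachine
     inputAlphabet := Equiv.refl Bool
     outputAlphabet := Equiv.refl Bool
     time := 1
     outputsFun := fun k =>
      { steps := 1
        evals_in_steps := by
          refine congrArg (fun S => some (Turing.TM2.Cfg.mk none () S)) (funext fun c => ?_)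
          cases k <;> cases c
          · rfl
          · exact (List.map_id _).trans (List.map_id _).symm
        steps_le_m := by simp } }⟩

/-- The machine that writes two symbols for every symbol that it reads and finally removes one
symbol if `b` is true. -/
def doubleMachine (b : Bool) : Turing.FinTM2 where
  K := Bool
  k₀ := false
  k₁ := true
  Γ _ := Bool
  Λ := Unit
  main := ()
  σ := Option Bool
  initialState := none
  m _ := .pop false (fun _ a => a)
    (.branch Option.isSome
      (.push true (fun _ => true) (.push true (fun _ => true) (.goto fun _ => ())))
      (if b then .pop true (fun s _ => s) .halt else .halt))

theorem unaryEncodeNat_eq (n : ℕ) : Computability.unaryEncodeNat n = List.replicate n true := by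
  induction n with
  | zero => rfl
  | succ n ih => rw [Computability.unaryEncodeNat, ih, List.replicate_succ]

/-- A configuration of `doubleMachine b` with `i` symbols on the input stack and `j` on the
output stack. -/
def doubleCfg (b : Bool) (l : Option Unit) (s : Option Bool) (i j : ℕ) : (doubleMachine b).Cfg :=
  ⟨l, s, fun k => List.replicate (cond k j i) true⟩

theorem doubleMachine_loop (b : Bool) (i j : ℕ) (s : Option Bool) :
    (flip bind (doubleMachine b).step)^[i + 1] (some (doubleCfg b (some ()) s i j)) =
      some (doubleCfg b none none 0 (j + 2 * i - cond b 1 0)) := by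
  induction i generalizing j s with
  | zero =>
    cases b
    · refine congrArg (fun S => some (Turing.TM2.Cfg.mk none none S)) (funext fun c => ?_)
      cases c <;> rfl
    · refine congrArg (fun S => some (Turing.TM2.Cfg.mk none none S)) (funext fun c => ?_)
      cases c
      · rfl
      · exact List.tail_replicate
  | succ i ih =>
    rw [Function.iterate_succ_apply]
    have h : flip bind (doubleMachine b).step (some (doubleCfg b (some ()) s (i + 1) j)) =
        some (doubleCfg b (some ()) (some true) i (j + 2)) := by
      refine congrArg (fun S => some (Turing.TM2.Cfg.mk (some ()) (some true) S))
        (funext fun c => ?_)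
      cases c <;> rfl
    rw [h, ih]
    congr 2
    omega

theorem polyTimeLength_double (b : Bool) : PolyTimeLength fun k => 2 * k - cond b 1 0 :=
  ⟨{ tm := doubleMachine b
     inputAlphabet := Equiv.refl Bool
     outputAlphabet := Equiv.refl Bool
     time := Polynomial.X + 1
     outputsFun := fun k =>
      { steps := k + 1
        evals_in_steps := by
          have h := doubleMachine_loop b k 0 none
          rw [Nat.zero_add] at h
          rw [unaryEncodeNat_eq, unaryEncodeNat_eq]
          refine Eq.trans (congrArg _ ?_) (h.trans ?_)
          · refine congrArg (fun S => some (Turing.TM2.Cfg.mk (some ()) none S))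
              (funext fun c => ?_)
            cases c
            · exact List.map_id _
            · rfl
          · refine congrArg (fun S => some (Turing.TM2.Cfg.mk none none S))
              (funext fun c => ?_)
            cases c
            · rfl
            · exact (List.map_id _).symm
        steps_le_m := by simp [unaryEncodeNat_eq] } }⟩

/-! ### The two problems -/

/-- The problem of finding distinct `x₁`, `x₂` (coded as one string) of length `|x|` with
`O x₁ = O x₂`, where `O` maps strings of length `|x|` to strings of length `|x| - 1`.
In the degenerate case `|x| = 0` every candidate counts as a solution. -/
def weakPigeon : QueryTFNP where
  la k := k - 1
  ls k := k + k
  la_polyTime := polyTimeLength_pred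
  ls_polyTime := by simpa [two_mul] using polyTimeLength_double false
  Sol x O y := x = [] ∨ (y.fst ≠ y.snd ∧ O y.fst = O y.snd)
  verifiable := by
    classical
    refine ⟨2, fun x y => ⟨.node y.fst fun a => .node y.snd fun b =>
      .leaf fun _ => decide (x = [] ∨ (y.fst ≠ y.snd ∧ a = b)), ?_, fun O => ?_⟩⟩
    · simp [QueryTree.depth]
    · simp [QueryTree.run, funext_iff]
  total := by
    intro x O
    by_cases hx : x = []
    · exact ⟨fun _ => false, Or.inl hx⟩
    · have hl : 0 < x.length := List.length_pos_iff.2 hx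
      obtain ⟨a, b, hab, h⟩ := Fintype.exists_ne_map_eq_of_card_lt O (by
        simpa using Nat.pow_lt_pow_right (by norm_num : 1 < 2) (by omega : x.length - 1 < x.length))
      have h1 : Bits.fst (Fin.append a b) = a := by funext i; simp [Bits.fst]
      have h2 : Bits.snd (Fin.append a b) = b := by
        funext i; exact Fin.append_right a b i
      exact ⟨Fin.append a b, Or.inr (by rw [h1, h2]; exact ⟨hab, h⟩)⟩

/-- The oracle `f` from strings of length `k` to strings of length `k - 1` that is given by a
combined oracle: the first part of each answer. -/
def oracleF {k : ℕ} (O : Bits k → Bits ((k - 1) + k)) (z : Bits k) : Bits (k - 1) := (O z).fst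

/-- The oracle `g` from strings of length `k - 1` to strings of length `k` that is given by a
combined oracle: the second part of the answer, the query being padded with a leading zero. -/
def oracleG {k : ℕ} (O : Bits k → Bits ((k - 1) + k)) (z : Bits (k - 1)) : Bits k := (O z.pad).snd

/-- Every pair of oracles is given by a combined oracle. -/
theorem exists_combined_oracle {k : ℕ} (hk : 0 < k) (f : Bits k → Bits (k - 1))
    (g : Bits (k - 1) → Bits k) : ∃ O, oracleF O = f ∧ oracleG O = g := by
  refine ⟨fun z => Fin.append (f z) (g fun i => z ⟨i.val + 1, by omega⟩), ?_, ?_⟩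
  · funext z i
    simp [oracleF, Bits.fst]
  · funext z i
    simp [oracleG, Bits.snd, Bits.pad]

/-- The problem of finding `x'` of length `|x|` with `g (f x') ≠ x'`, where `f` maps strings of
length `|x|` to strings of length `|x| - 1` and `g` maps strings of length `|x| - 1` to strings of
length `|x|`. The pair `(f, g)` is given by one oracle that answers queries to both in parallel.
In the degenerate case `|x| = 0` every candidate counts as a solution. -/
def retractionWeakPigeon : QueryTFNP where
  la k := (k - 1) + k
  ls k := k
  la_polyTime := by
    have h : (fun k => 2 * k - cond true 1 0) = fun k : ℕ => (k - 1) + k := by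
      funext k; simp only [cond_true]; omega
    exact h ▸ polyTimeLength_double true
  ls_polyTime := polyTimeLength_id
  Sol x O x' := x = [] ∨ oracleG O (oracleF O x') ≠ x'
  verifiable := by
    classical
    refine ⟨2, fun x x' => ⟨.node x' fun a => .node a.fst.pad fun b =>
      .leaf fun _ => decide (x = [] ∨ b.snd ≠ x'), ?_, fun O => ?_⟩⟩
    · simp [QueryTree.depth]
    · simp [QueryTree.run, funext_iff, oracleG, oracleF]
  total := by
    intro x O
    by_cases hx : x = []
    · exact ⟨fun _ => false, Or.inl hx⟩
    · have hl : 0 < x.length := List.length_pos_iff.2 hx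
      by_contra hcon
      push Not at hcon
      have hinj : Function.Injective (oracleF O) :=
        Function.LeftInverse.injective fun x' => (hcon x').2
      have hc := Fintype.card_le_of_injective _ hinj
      have hlt := Nat.pow_lt_pow_right (by norm_num : 1 < 2)
        (by omega : x.length - 1 < x.length)
      simp at hc
      omega

/-!
The retraction problem is easy for randomized search while the weak pigeonhole problem is not.

For `f : {0,1}^K → {0,1}^(K-1)` and `g : {0,1}^(K-1) → {0,1}^K`, every string outside the range
of `g` solves the retraction problem, so at least half of all candidates are solutions
(`card_le_two_mul_card_retraction_solutions`). Under a many-one reduction, for each oracle `O` at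
least half of the trees `Ts y'` therefore return a collision of `O`; averaging over `O` and `y'`,
one of these trees, of polynomial depth `d`, finds a collision of at least half of all oracles.

On the other hand, a tree of depth `d` finds a collision of a uniformly random oracle with values
in a set of size `N` with probability at most `(d ^ 2 + 1) / N`: each new query hits one of the
answers seen before with probability at most `d / N`, and if no two answers seen agree, then the
pair at the leaf contains a point that was not queried and collides with probability at most
`1 / N` (`QueryTree.card_collisions_le`). Since `N = 2 ^ (k - 1)` outgrows every polynomial in `k`,
this is a contradiction.
-/

/-! ### Oracles that agree with given answers -/

section Cylinder

variable {α β : Type*} [Fintype α] [DecidableEq α] [Fintype β] [DecidableEq β]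

/-- The functions that agree with `ρ` on `S`: the oracles that remain possible after the queries
in `S` have been answered according to `ρ`. The values of `ρ` outside `S` are irrelevant. -/
def cylinder (S : Finset α) (ρ : α → β) : Finset (α → β) :=
  Finset.univ.filter fun O => ∀ q ∈ S, O q = ρ q

theorem mem_cylinder {S : Finset α} {ρ O : α → β} :
    O ∈ cylinder S ρ ↔ ∀ q ∈ S, O q = ρ q := by
  simp [cylinder]

theorem pow_card_mul_card_cylinder (S : Finset α) (ρ : α → β) :
    Fintype.card β ^ S.card * (cylinder S ρ).card = Fintype.card (α → β) := by
  have h : cylinder S ρ =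
      Fintype.piFinset fun q => if q ∈ S then {ρ q} else (Finset.univ : Finset β) := by
    ext O
    rw [mem_cylinder, Fintype.mem_piFinset]
    refine forall_congr' fun q => ?_
    by_cases hq : q ∈ S <;> simp [hq]
  have h2 : ∀ q, (if q ∈ S then {ρ q} else (Finset.univ : Finset β)).card =
      if q ∈ S then 1 else Fintype.card β := by
    intro q
    split_ifs <;> simp
  rw [h, Fintype.card_piFinset, Finset.prod_congr rfl fun q _ => h2 q, Finset.prod_ite,
    Finset.prod_const_one, one_mul, Finset.prod_const, Finset.filter_not,
    Finset.filter_mem_eq_inter, Finset.univ_inter, ← pow_add, Finset.card_sdiff_of_subset (Finset.subset_univ S),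
    Finset.card_univ, Nat.add_sub_cancel' (Finset.card_le_univ S), Fintype.card_fun]

theorem mem_cylinder_insert_update {S : Finset α} {ρ O : α → β} {q : α} (hq : q ∉ S) (w : β) :
    O ∈ cylinder (insert q S) (Function.update ρ q w) ↔ O ∈ cylinder S ρ ∧ O q = w := by
  simp only [mem_cylinder, Finset.forall_mem_insert, Function.update_self, and_comm (a := O q = w)]
  refine and_congr_left fun _ => forall₂_congr fun a ha => ?_
  rw [Function.update_of_ne (ne_of_mem_of_not_mem ha hq)]

/-- A value outside the queries answered so far agrees with any other value with probability
`1 / |β|`. -/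
theorem card_mul_card_filter_eq_le_card_cylinder {S : Finset α} (ρ : α → β) {a b : α} (hab : a ≠ b)
    (hb : b ∉ S) :
    Fintype.card β * ((cylinder S ρ).filter fun O => O a = O b).card ≤ (cylinder S ρ).card := by
  rw [← Finset.card_univ, ← Finset.card_product]
  refine Finset.card_le_card_of_injOn (fun wO => Function.update wO.2 b wO.1) ?_ ?_
  · rintro ⟨w, O⟩ h
    simp only [Finset.coe_product, Set.mem_prod, Finset.mem_coe, Finset.mem_filter,
      mem_cylinder] at h ⊢
    intro q hq
    rw [Function.update_of_ne (ne_of_mem_of_not_mem hq hb)]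
    exact h.2.1 q hq
  · rintro ⟨w, O⟩ h ⟨w', O'⟩ h' heq
    simp only [Finset.coe_product, Set.mem_prod, Finset.mem_coe, Finset.mem_filter] at h h' heq
    have key : ∀ q, q ≠ b → O q = O' q := fun q hq => by
      simpa [hq] using congrFun heq q
    have hw : w = w' := by simpa using congrFun heq b
    refine Prod.ext hw (funext fun q => ?_)
    by_cases hq : q = b
    -- The overwritten value `O b` is recovered as `O a`.
    · exact hq ▸ h.2.2.symm.trans ((key a hab).trans h'.2.2)
    · exact key q hq

end Cylinder

/-! ### Query trees rarely find collisions -/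

namespace QueryTree

theorem depth_child_lt {kq ka ko : ℕ} (q : Bits kq) (child : Bits ka → QueryTree kq ka ko)
    (w : Bits ka) : (child w).depth < (node q child).depth :=
  Nat.lt_succ_of_le (Finset.le_sup (f := fun w => (child w).depth) (Finset.mem_univ w))

/-- The oracles of which the tree `T` outputs a collision. -/
def collisions {k m : ℕ} (T : QueryTree k m (k + k)) : Finset (Bits k → Bits m) :=
  Finset.univ.filter fun O =>
    (T.run O).fst ≠ (T.run O).snd ∧ O (T.run O).fst = O (T.run O).snd

theorem mem_collisions {k m : ℕ} {T : QueryTree k m (k + k)} {O : Bits k → Bits m} :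
    O ∈ T.collisions ↔ (T.run O).fst ≠ (T.run O).snd ∧ O (T.run O).fst = O (T.run O).snd := by
  simp [collisions]

/-- The induction behind `card_collisions_le`: the queries in `S` have been answered, with pairwise
distinct answers, and `T` is what remains of the computation. The bound `D` on the number of all
queries is fixed, so that each of the remaining ones costs `D` in the numerator. -/
theorem card_cylinder_inter_collisions_le {k m D : ℕ} (T : QueryTree k m (k + k))
    (S : Finset (Bits k)) (ρ : Bits k → Bits m) (hρ : Set.InjOn ρ S) (hD : S.card + T.depth ≤ D) :
    2 ^ m * (cylinder S ρ ∩ T.collisions).card ≤ (T.depth * D + 1) * (cylinder S ρ).card := by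
  have hN : Fintype.card (Bits m) = 2 ^ m := by simp
  induction T generalizing S ρ with
  | leaf out =>
    simp only [depth, zero_mul, zero_add, one_mul]
    by_cases hne : out.fst = out.snd
    · have : cylinder S ρ ∩ (leaf out : QueryTree k m (k + k)).collisions = ∅ := by
        ext O; simp [mem_collisions, run, hne]
      simp [this]
    have hset : cylinder S ρ ∩ (leaf out : QueryTree k m (k + k)).collisions =
        (cylinder S ρ).filter fun O => O out.fst = O out.snd := by
      ext O; simp [mem_collisions, run, hne]
    rw [hset, ← hN]
    by_cases hb : out.snd ∈ S
    · by_cases ha : out.fst ∈ S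
      · have : (cylinder S ρ).filter (fun O => O out.fst = O out.snd) = ∅ := by
          refine Finset.filter_eq_empty_iff.2 fun O hO h => hne (hρ ha hb ?_)
          rw [mem_cylinder] at hO
          rw [← hO _ ha, ← hO _ hb, h]
        simp [this]
      · simpa only [eq_comm] using
          card_mul_card_filter_eq_le_card_cylinder ρ (Ne.symm hne) ha
    · exact card_mul_card_filter_eq_le_card_cylinder ρ hne hb
  | node q child ih =>
    obtain ⟨e, he⟩ : ∃ e, (node q child).depth = e + 1 := ⟨_, rfl⟩
    have hchild : ∀ w, (child w).depth ≤ e := fun w => by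
      have := depth_child_lt q child w
      omega
    rw [he] at hD ⊢
    by_cases hq : q ∈ S
    · have hset : cylinder S ρ ∩ (node q child).collisions =
          cylinder S ρ ∩ (child (ρ q)).collisions := by
        ext O
        simp only [Finset.mem_inter, mem_collisions, run]
        refine and_congr_right fun hO => ?_
        rw [mem_cylinder.1 hO q hq]
      rw [hset]
      refine (ih (ρ q) S ρ hρ (by have := hchild (ρ q); omega)).trans ?_
      gcongr
      exact (hchild _).trans e.le_succ
    -- The answer to a new query splits the cylinder into parts of equal size `M`.
    · obtain ⟨M, hM⟩ : ∃ M, ∀ w, (cylinder (insert q S) (Function.update ρ q w)).card = M := by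
        refine ⟨(cylinder (insert q S) ρ).card, fun w => ?_⟩
        have h := pow_card_mul_card_cylinder (insert q S) (Function.update ρ q w)
        rw [← pow_card_mul_card_cylinder (insert q S) ρ] at h
        exact Nat.eq_of_mul_eq_mul_left (pow_pos Fintype.card_pos _) h
      have hsplit : ∀ A : Finset (Bits k → Bits m), (cylinder S ρ ∩ A).card =
          ∑ w, (cylinder (insert q S) (Function.update ρ q w) ∩ A).card := by
        intro A
        rw [Finset.card_eq_sum_card_fiberwise (f := fun O => O q) (t := Finset.univ)
          (fun _ _ => Finset.mem_univ _)]
        refine Finset.sum_congr rfl fun w _ => congrArg _ ?_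
        ext O
        simp only [Finset.mem_filter, Finset.mem_inter, mem_cylinder_insert_update hq]
        tauto
      have hC : (cylinder S ρ).card = 2 ^ m * M := by
        have := hsplit Finset.univ
        simpa [hM] using this
      -- An answer that was seen before is charged the whole part of the cylinder.
      have hw : ∀ w, 2 ^ m * (cylinder (insert q S) (Function.update ρ q w) ∩
          (node q child).collisions).card ≤
            (e * D + 1) * M + if w ∈ S.image ρ then 2 ^ m * M else 0 := by
        intro w
        split_ifs with h
        · refine le_trans ?_ (Nat.le_add_left _ _)
          gcongr
          rw [← hM w]
          exact Finset.card_le_card Finset.inter_subset_left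
        · have hset : cylinder (insert q S) (Function.update ρ q w) ∩ (node q child).collisions =
              cylinder (insert q S) (Function.update ρ q w) ∩ (child w).collisions := by
            ext O
            simp only [Finset.mem_inter, mem_collisions, run]
            refine and_congr_right fun hO => ?_
            rw [((mem_cylinder_insert_update hq w).1 hO).2]
          have hinj : Set.InjOn (Function.update ρ q w) (insert q S : Finset (Bits k)) := by
            have heq : Set.EqOn ρ (Function.update ρ q w) S := fun a ha =>
              (Function.update_of_ne (ne_of_mem_of_not_mem (Finset.mem_coe.1 ha) hq) _ _).symm
            rw [Finset.coe_insert, Set.injOn_insert (by simpa using hq), ← heq.image_eq]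
            exact ⟨hρ.congr heq, by simpa using h⟩
          have hcard := Finset.card_insert_of_notMem hq
          have := ih w (insert q S) (Function.update ρ q w) hinj
            (by have := hchild w; omega)
          rw [hM] at this
          rw [hset, add_zero]
          refine this.trans ?_
          gcongr
          exact hchild w
      have himage : (S.image ρ).card ≤ D := Finset.card_image_le.trans (by omega)
      calc 2 ^ m * (cylinder S ρ ∩ (node q child).collisions).card
          = ∑ w, 2 ^ m * (cylinder (insert q S) (Function.update ρ q w) ∩
              (node q child).collisions).card := by rw [hsplit, Finset.mul_sum]
        _ ≤ ∑ w : Bits m, ((e * D + 1) * M + if w ∈ S.image ρ then 2 ^ m * M else 0) :=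
            Finset.sum_le_sum fun w _ => hw w
        _ = 2 ^ m * ((e * D + 1) * M) + (S.image ρ).card * (2 ^ m * M) := by
            rw [Finset.sum_add_distrib, Finset.sum_const, Finset.card_univ, hN, smul_eq_mul,
              ← Finset.sum_filter, Finset.sum_const, smul_eq_mul, Finset.filter_mem_eq_inter,
              Finset.univ_inter]
        _ ≤ 2 ^ m * ((e * D + 1) * M) + D * (2 ^ m * M) := by gcongr
        _ = ((e + 1) * D + 1) * (cylinder S ρ).card := by rw [hC]; ring

/-- A query tree of depth at most `d` finds a collision of a random oracle with answers of length
`m` with probability at most `(d ^ 2 + 1) / 2 ^ m`. -/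
theorem card_collisions_le {k m d : ℕ} (T : QueryTree k m (k + k)) (hd : T.depth ≤ d) :
    2 ^ m * T.collisions.card ≤ (d ^ 2 + 1) * Fintype.card (Bits k → Bits m) := by
  have h := T.card_cylinder_inter_collisions_le (D := d) ∅ (fun _ _ => false) (by simp)
    (by simpa using hd)
  have hc : cylinder ∅ (fun _ _ => false : Bits k → Bits m) = Finset.univ := by
    ext O; simp [mem_cylinder]
  rw [hc, Finset.univ_inter, Finset.card_univ] at h
  refine h.trans ?_
  rw [sq]
  gcongr

end QueryTree

/-! ### Most candidates solve the retraction problem -/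

open Classical in
/-- At least half of the candidates are solutions of the retraction problem, as all strings outside
the range of `g` are; for `x = []` the only candidate counts as one by convention. -/
theorem card_le_two_mul_card_retraction_solutions (x : List Bool)
    (O : Bits x.length → Bits (retractionWeakPigeon.la x.length)) :
    2 ^ x.length ≤ 2 * (Finset.univ.filter fun y => retractionWeakPigeon.Sol x O y).card := by
  rcases x with _ | ⟨b, x⟩
  · have : (Finset.univ.filter fun y => retractionWeakPigeon.Sol [] O y) = Finset.univ :=
      Finset.filter_true_of_mem fun y _ => Or.inl rfl
    rw [this]
    exact (by simp : 2 ^ 0 ≤ 2 * (Finset.univ : Finset (Bits 0)).card)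
  · have hsub : (Finset.univ.filter fun y => ¬ retractionWeakPigeon.Sol (b :: x) O y) ⊆
        Finset.univ.image (oracleG (k := (b :: x).length) O) := by
      intro y hy
      have hy : ¬ (b :: x = [] ∨ oracleG O (oracleF O y) ≠ y) := (Finset.mem_filter.1 hy).2
      push Not at hy
      exact Finset.mem_image.2 ⟨_, Finset.mem_univ _, hy.2⟩
    have hle := (Finset.card_le_card hsub).trans Finset.card_image_le
    have hsum := Finset.card_filter_add_card_filter_not (s := Finset.univ)
      (fun y => retractionWeakPigeon.Sol (b :: x) O y)
    have hu : (Finset.univ : Finset (Bits (b :: x).length)).card = 2 ^ (b :: x).length := by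
      rw [Finset.card_univ]; simp
    have hsum := hsum.trans hu
    have hv : (Finset.univ : Finset (Bits ((b :: x).length - 1))).card = 2 ^ x.length := by
      simp
    have hpow : 2 ^ (b :: x).length = 2 ^ x.length * 2 := by rw [List.length_cons, pow_succ]
    omega

/-! ### Polynomials against powers of two -/

theorem tendsto_polynomial_eval_div_two_pow (p : Polynomial ℕ) :
    Filter.Tendsto (fun n : ℕ => ((p.eval n : ℕ) : ℝ) / 2 ^ n) Filter.atTop (nhds 0) := by
  induction p using Polynomial.induction_on' with
  | add p q hp hq => simpa [add_div] using hp.add hq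
  | monomial i a =>
    simpa [mul_div_assoc] using
      (tendsto_pow_const_div_const_pow_of_one_lt i (one_lt_two (α := ℝ))).const_mul (a : ℝ)

theorem exists_polynomial_eval_lt_two_pow (p : Polynomial ℕ) : ∃ n, p.eval n < 2 ^ n := by
  obtain ⟨n, hn⟩ := ((tendsto_polynomial_eval_div_two_pow p).eventually_lt_const one_pos).exists
  refine ⟨n, ?_⟩
  rw [div_lt_one (by positivity)] at hn
  exact_mod_cast hn

/-! ### The separation -/

/-- There is no many-one reduction from the weak pigeonhole problem to the retraction weak
pigeonhole problem. -/
theorem theorem6p11 : ¬ weakPigeon.ManyOneReducible retractionWeakPigeon := by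
  classical
  rintro ⟨r, -, p, h⟩
  obtain ⟨k, hk⟩ := exists_polynomial_eval_lt_two_pow (4 * (p ^ 2 + 1))
  obtain ⟨x, rfl⟩ : ∃ x : List Bool, x.length = k := ⟨List.replicate k true, by simp⟩
  have hx0 : x ≠ [] := by
    rintro rfl
    simp at hk
  obtain ⟨TI, Ts, -, hTs, hred⟩ := h x
  set d := p.eval x.length with hd
  set B := Fintype.card (Bits x.length → Bits (weakPigeon.la x.length))
  have hB : 0 < B := Fintype.card_pos
  -- For every oracle, at least half of the trees `Ts y` find a collision.
  have hmany : ∀ O : Bits x.length → Bits (weakPigeon.la x.length),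
      2 ^ (r x).length ≤ 2 * (Finset.univ.filter fun y => O ∈ (Ts y).collisions).card := by
    intro O
    refine (card_le_two_mul_card_retraction_solutions (r x) fun x' => (TI x').run O).trans ?_
    gcongr with y
    intro hy
    exact QueryTree.mem_collisions.2 ((hred O y hy).resolve_left hx0)
  have hfew : ∀ y, 2 ^ (x.length - 1) * (Ts y).collisions.card ≤ (d ^ 2 + 1) * B :=
    fun y => QueryTree.card_collisions_le (Ts y) (hTs y)
  have hdouble : ∑ O, (Finset.univ.filter fun y => O ∈ (Ts y).collisions).card =
      ∑ y, (Ts y).collisions.card := by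
    simpa [Finset.bipartiteAbove, Finset.bipartiteBelow] using
      Finset.sum_card_bipartiteAbove_eq_sum_card_bipartiteBelow (s := Finset.univ)
        (t := Finset.univ) fun (O : Bits x.length → Bits (weakPigeon.la x.length)) y =>
          O ∈ (Ts y).collisions
  have hcard : Fintype.card (Bits (retractionWeakPigeon.ls (r x).length)) =
      2 ^ (r x).length :=
    (by simp : Fintype.card (Bits (r x).length) = 2 ^ (r x).length)
  have hlow : B * 2 ^ (r x).length ≤ 2 * ∑ y, (Ts y).collisions.card := by
    rw [← hdouble, Finset.mul_sum]
    simpa [B] using Finset.sum_le_sum fun O (_ : O ∈ Finset.univ) => hmany O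
  have hup : 2 ^ (x.length - 1) * ∑ y, (Ts y).collisions.card ≤
      2 ^ (r x).length * ((d ^ 2 + 1) * B) := by
    rw [Finset.mul_sum]
    refine (Finset.sum_le_sum fun y _ => hfew y).trans ?_
    rw [Finset.sum_const, Finset.card_univ, hcard, smul_eq_mul]
  have hle : 2 ^ (x.length - 1) * (B * 2 ^ (r x).length) ≤
      2 * (d ^ 2 + 1) * (B * 2 ^ (r x).length) := by
    calc 2 ^ (x.length - 1) * (B * 2 ^ (r x).length)
        ≤ 2 ^ (x.length - 1) * (2 * ∑ y, (Ts y).collisions.card) := by gcongr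
      _ = 2 * (2 ^ (x.length - 1) * ∑ y, (Ts y).collisions.card) := by ring
      _ ≤ 2 * (2 ^ (r x).length * ((d ^ 2 + 1) * B)) := by gcongr
      _ = 2 * (d ^ 2 + 1) * (B * 2 ^ (r x).length) := by ring
  have hfinal := Nat.le_of_mul_le_mul_right hle (by positivity)
  have hpow : 2 ^ x.length = 2 * 2 ^ (x.length - 1) := by
    rw [← pow_succ', Nat.sub_add_cancel (List.length_pos_iff.2 hx0)]
  have heval : (4 * (p ^ 2 + 1)).eval x.length = 4 * (d ^ 2 + 1) := by simp [hd]
  omega
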